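/- A quantum channel on $\mathbb{C}^d$ is a completely positive trace-preserving linear map $\mathcal N$ on the space $L(\mathbb{C}^d)$ of $d\times d$ complex matrices. It is entanglement-breaking if, with $\mathcal I$ the identity map on $L(\mathbb{C}^d)$, the state $(\mathcal N\otimes\mathcal I)(|\Psi\rangle\langle\Psi|)$ is separable (a finite convex combination of products of density matrices) for every unit vector $\Psi\in\mathbb{C}^d\otimes\mathbb{C}^d$. A one-bit protocol assisted by shared randomness consists of: a pair of finite classical systems held by Alice and Bob, with a joint probability distribution $p(i,j)$; for every value $i$ of Alice's system, a two-outcome measurement (POVM) $\{M^{(i)}_0,M^{(i)}_1\}$ that she performs on the input, sending the outcome $m\in\{0,1\}$ to Bob through a noiseless bit channel; and, for every value $j$ of Bob's system and every message $m$, a density matrix $\tau^{(j)}_m$ that Bob prepares. The protocol simulates $\mathcal N$ if $\mathcal N(\rho)=\sum_{i,j}p(i,j)\sum_{m}\operatorname{Tr}[M^{(i)}_m\rho]\,\tau^{(j)}_m$ for all $\rho$. **Proposition.** Every entanglement-breaking qubit channel $\mathcal N$ (the case $d=2$) can be simulated by a one-bit protocol assisted by shared randomness. Concretely, there are a positive integer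 $K$, a probability distribution $(q_i)_{i=1}^K$, orthonormal bases $\{|\psi^{(i)}_0\rangle,|\psi^{(i)}_1\rangle\}$ of $\mathbb{C}^2$ and qubit density matrices $\sigma^{(i)}_0,\sigma^{(i)}_1$ ($i=1,\dots,K$) such that $$\mathcal N(\rho)=\sum_{i=1}^K q_i\sum_{m\in\{0,1\}}\langle\psi^{(i)}_m|\rho|\psi^{(i)}_m\rangle\,\sigma^{(i)}_m\qquad\text{for all }\rho\in L(\mathbb{C}^2),$$ and $\mathcal N$ is simulated by the following protocol: Alice and Bob share perfectly correlated $K$-dimensional classical systems with distribution $p(i,j)=q_j\,\delta_{ij}$; for the value $i$, Alice measures the qubit in the basis $\{|\psi^{(i)}_0\rangle,|\psi^{(i)}_1\rangle\}$ and sends the outcome $m$ to Bob through the noiseless bit channel, and Bob prepares $\sigma^{(i)}_m$. -/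

import Mathlib

open scoped Kronecker Matrix ComplexOrder

/-- The operators on the Hilbert space `ℂ^d`. -/
abbrev Op (d : ℕ) : Type := Matrix (Fin d) (Fin d) ℂ

/-- Density matrices: positive semidefinite matrices of unit trace. -/
def IsDensityMatrix {ι : Type} [Fintype ι] (ρ : Matrix ι ι ℂ) : Prop :=
  ρ.PosSemidef ∧ ρ.trace = 1

/-- The rank-one operator `|v⟩⟨v|`. -/
def ketBra {ι : Type} (v : EuclideanSpace ℂ ι) : Matrix ι ι ℂ :=
  Matrix.vecMulVec v.ofLp (star v.ofLp)

/-- The map `N ⊗ I`, with `I` the identity map on `L(ℂ^k)`: it applies `N` to the `(a, b)` block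
of a block matrix, for all indices `a, b` of the second tensor factor. -/
def tensorId {d : ℕ} (N : Op d →ₗ[ℂ] Op d) (k : ℕ) :
    Matrix (Fin d × Fin k) (Fin d × Fin k) ℂ →ₗ[ℂ] Matrix (Fin d × Fin k) (Fin d × Fin k) ℂ where
  toFun X := Matrix.of fun x y => N (Matrix.of fun i j => X (i, x.2) (j, y.2)) x.1 y.1
  map_add' X Y := by
    ext x y
    exact congrFun (congrFun (N.map_add (Matrix.of fun i j => X (i, x.2) (j, y.2))
      (Matrix.of fun i j => Y (i, x.2) (j, y.2))) x.1) y.1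
  map_smul' c X := by
    ext x y
    exact congrFun (congrFun (N.map_smul c (Matrix.of fun i j => X (i, x.2) (j, y.2))) x.1) y.1

/-- `tensorId N k` is the linear map that sends `A ⊗ B` to `N(A) ⊗ B`. -/
theorem tensorId_kronecker {d k : ℕ} (N : Op d →ₗ[ℂ] Op d) (A : Op d) (B : Op k) :
    tensorId N k (A ⊗ₖ B) = N A ⊗ₖ B := by
  ext x y
  have h : (Matrix.of fun i j => (A ⊗ₖ B) (i, x.2) (j, y.2)) = B x.2 y.2 • A := by
    ext i j
    simp [mul_comm]
  change N (Matrix.of fun i j => (A ⊗ₖ B) (i, x.2) (j, y.2)) x.1 y.1 = _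
  rw [h, N.map_smul]
  simp [mul_comm]

/-- Quantum channels on a `d`-dimensional system: completely positive trace-preserving maps. -/
structure IsQuantumChannel {d : ℕ} (N : Op d →ₗ[ℂ] Op d) : Prop where
  completelyPositive : ∀ (k : ℕ) (X : Matrix (Fin d × Fin k) (Fin d × Fin k) ℂ),
    X.PosSemidef → (tensorId N k X).PosSemidef
  tracePreserving : ∀ X : Op d, (N X).trace = X.trace

/-- Separable bipartite states: convex combinations of products of density matrices. -/
def IsSeparableState {d k : ℕ} (ω : Matrix (Fin d × Fin k) (Fin d × Fin k) ℂ) : Prop :=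
  ∃ (n : ℕ) (p : Fin n → ℝ) (ρ : Fin n → Op d) (τ : Fin n → Op k),
    p ∈ stdSimplex ℝ (Fin n) ∧
    (∀ i, IsDensityMatrix (ρ i)) ∧ (∀ i, IsDensityMatrix (τ i)) ∧
    ω = ∑ i, (p i : ℂ) • (ρ i ⊗ₖ τ i)

/-- Entanglement-breaking channels: quantum channels `N` on `L(H)`, `H = ℂ^d`, such that
`(N ⊗ I)(|Ψ⟩⟨Ψ|)`, with `I` the identity on `L(H)`, is separable for every unit vector
`Ψ ∈ H ⊗ H`. -/
structure IsEntanglementBreaking {d : ℕ} (N : Op d →ₗ[ℂ] Op d) : Prop where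
  isQuantumChannel : IsQuantumChannel N
  separable : ∀ Ψ : EuclideanSpace ℂ (Fin d × Fin d), ‖Ψ‖ = 1 →
    IsSeparableState (tensorId N d (ketBra Ψ))

/-- A one-bit protocol assisted by shared randomness, for the transmission of a `d`-dimensional
quantum system. Alice and Bob hold classical systems of dimensions `KA` and `KB` with joint
distribution `shared`. If Alice's system is in the state `i`, she measures the input with the
two-outcome measurement (POVM) `meas i` and feeds the outcome into a classical bit channel.
If Bob's system is in the state `j` and he receives `m`, he prepares the state `prep j m`. -/
structure BitProtocol (d KA KB : ℕ) where
  shared : Fin KA × Fin KB → ℝ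
  shared_mem : shared ∈ stdSimplex ℝ (Fin KA × Fin KB)
  meas : Fin KA → Fin 2 → Op d
  meas_posSemidef : ∀ i m, (meas i m).PosSemidef
  meas_sum : ∀ i, ∑ m, meas i m = 1
  prep : Fin KB → Fin 2 → Op d
  prep_density : ∀ j m, IsDensityMatrix (prep j m)

/-- The transition probabilities `p(m' | m)` (row `m`, column `m'`) of the noiseless bit channel:
the message received is the message sent. -/
def noiselessBit : Matrix (Fin 2) (Fin 2) ℝ := 1

/-- The map from input states to (average) output states realized by a protocol that uses a
classical bit channel with transition probabilities `W`. -/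
noncomputable def BitProtocol.realizedMap {d KA KB : ℕ} (P : BitProtocol d KA KB)
    (W : Matrix (Fin 2) (Fin 2) ℝ) : Op d →ₗ[ℂ] Op d where
  toFun ρ := ∑ i, ∑ j, ∑ m, ∑ m',
    ((P.shared (i, j) : ℂ) * (P.meas i m * ρ).trace * (W m m' : ℂ)) • P.prep j m'
  map_add' ρ τ := by
    simp only [Matrix.trace_add, mul_add, add_mul, add_smul,
      Finset.sum_add_distrib]
  map_smul' c ρ := by
    simp only [Matrix.mul_smul, Matrix.trace_smul, smul_eq_mul, RingHom.id_apply,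
      Finset.smul_sum, smul_smul]
    refine Finset.sum_congr rfl fun i _ => Finset.sum_congr rfl fun j _ =>
      Finset.sum_congr rfl fun m _ => Finset.sum_congr rfl fun m' _ => ?_
    congr 1
    ring

/-- The protocol `P`, run over the noiseless bit channel, reproduces the map `N` exactly. -/
def BitProtocol.Simulates {d KA KB : ℕ} (P : BitProtocol d KA KB) (N : Op d →ₗ[ℂ] Op d) : Prop :=
  P.realizedMap noiselessBit = N

/-- The qubit CQ channel `ρ ↦ ∑ₘ ⟨ψₘ|ρ|ψₘ⟩ σₘ`. -/
noncomputable def cqMap (ψ : OrthonormalBasis (Fin 2) ℂ (EuclideanSpace ℂ (Fin 2)))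
    (σ : Fin 2 → Op 2) : Op 2 →ₗ[ℂ] Op 2 where
  toFun ρ := ∑ m, (star (ψ m).ofLp ⬝ᵥ (ρ *ᵥ (ψ m).ofLp)) • σ m
  map_add' ρ τ := by
    simp only [Matrix.add_mulVec, dotProduct_add, add_smul, Finset.sum_add_distrib]
  map_smul' c ρ := by
    simp only [Matrix.smul_mulVec, dotProduct_smul, smul_eq_mul, RingHom.id_apply,
      Finset.smul_sum, smul_smul]

/-- The projectors on the vectors of an orthonormal basis sum to the identity. -/
theorem sum_ketBra {d : ℕ} (ψ : OrthonormalBasis (Fin d) ℂ (EuclideanSpace ℂ (Fin d))) :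
    ∑ m, ketBra (ψ m) = 1 := by
  ext a b
  have h := congrArg (fun v : EuclideanSpace ℂ (Fin d) => v a)
    (ψ.sum_repr' (EuclideanSpace.single b (1 : ℂ)))
  simp only [EuclideanSpace.inner_single_right] at h
  simp only [ketBra, Matrix.sum_apply, Matrix.vecMulVec_apply]
  simpa [Matrix.one_apply, mul_comm, Pi.single_apply] using h

/-- The protocol for a mixture of CQ channels with probabilities `q`, bases `ψ` and output states
`σ`. Alice and Bob share perfectly correlated systems, `p(i, j) = q j δ_{ij}`; for the value `i`,
Alice measures in the orthonormal basis `ψ i` and communicates the outcome `m`, and Bob prepares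
`σ i m`. -/
noncomputable def cqProtocol {K : ℕ} (q : Fin K → ℝ) (hq : q ∈ stdSimplex ℝ (Fin K))
    (ψ : Fin K → OrthonormalBasis (Fin 2) ℂ (EuclideanSpace ℂ (Fin 2)))
    (σ : Fin K → Fin 2 → Op 2) (hσ : ∀ i m, IsDensityMatrix (σ i m)) : BitProtocol 2 K K where
  shared ij := if ij.1 = ij.2 then q ij.2 else 0
  shared_mem := by
    refine ⟨fun ij => ?_, ?_⟩
    · dsimp only
      split_ifs
      exacts [hq.1 _, le_rfl]
    · simpa [Fintype.sum_prod_type] using hq.2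
  meas i m := ketBra (ψ i m)
  meas_posSemidef i m := Matrix.posSemidef_vecMulVec_self_star _
  meas_sum i := sum_ketBra (ψ i)
  prep := σ
  prep_density := hσ

/-!
The state `(N ⊗ I)(|Φ⟩⟨Φ|)` for a maximally entangled `Φ` is separable, so `N` is of
measure-and-prepare form: with `aₖ, bₖ` in the Bloch ball and probabilities `pₖ`,
`N(X) = ∑ₖ pₖ · 2 Tr[ρ(bₖ) X] · ρ(aₖ)`, where `ρ(s) = (1 + s·σ) / 2`. Trace preservation says that
`∑ₖ pₖ bₖ = 0`, and then `N` depends only on the vector `∑ₖ pₖ aₖ` and the matrix `∑ₖ pₖ aₖ bₖᵀ`,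
in an affine way. It is therefore enough to show that the pair of these two lies in the convex hull
of the pairs that belong to channels measuring in one orthonormal basis. Those are the
families with two members of weight `1/2`, where `b` takes the values `n` and `-n` for a unit
vector `n` (`sum_blochTensor_mem_convexHull`).

This convex hull is compact, so a point outside it could be separated by a linear functional, which
has the form `(t, T) ↦ ⟨c, t⟩ + Tr[Mᵀ T]` and takes the value `⟨c + M b, a⟩` on `(a, a bᵀ)`. If `u`
bounds it on the hull, maximizing over the prepared states gives `‖c + M n‖ + ‖c - M n‖ ≤ 2u`
for all unit vectors `n`. An elementary estimate (`norm_add_le_of_norm_add_norm_sub_le`) turns this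
into the bound `‖c + M b‖ ≤ u + ⟨c, M b⟩ / u` on the whole unit ball. The right-hand side is affine
in `b`, so averaging with `∑ₖ pₖ bₖ = 0` leaves `∑ₖ pₖ ⟨c + M bₖ, aₖ⟩ ≤ u`: no functional separates.
-/

/-! ### Compactness of convex hulls -/

/-- By Carathéodory's theorem, the convex hull is the continuous image of a compact set of weights
and points, with as many points as the dimension plus one. -/
theorem isCompact_convexHull_of_finiteDimensional {E : Type*} [NormedAddCommGroup E]
    [NormedSpace ℝ E] [FiniteDimensional ℝ E] {s : Set E} (hs : IsCompact s) :
    IsCompact (convexHull ℝ s) := by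
  rcases s.eq_empty_or_nonempty with rfl | ⟨x₀, hx₀⟩
  · simp
  set d := Module.finrank ℝ E
  have key : convexHull ℝ s = (fun wz : (Fin (d + 1) → ℝ) × (Fin (d + 1) → E) =>
      ∑ i, wz.1 i • wz.2 i) '' (stdSimplex ℝ (Fin (d + 1)) ×ˢ Set.univ.pi fun _ => s) := by
    apply Set.Subset.antisymm
    · intro x hx
      obtain ⟨ι, _, z, w, hz, hind, hw, hw1, rfl⟩ := eq_pos_convex_span_of_mem_convexHull hx
      have hcard : Fintype.card ι ≤ Fintype.card (Fin (d + 1)) := by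
        rw [Fintype.card_fin]
        exact hind.card_le_finrank_succ.trans (Nat.succ_le_succ (Submodule.finrank_le _))
      obtain ⟨e⟩ := Function.Embedding.nonempty_of_card_le hcard
      have hwe : ∀ i, i ∉ Set.range e → Function.extend e w 0 i = 0 := fun i hi =>
        Function.extend_apply' _ _ _ (by simpa using hi)
      -- Pad the weights by zero and the points by an arbitrary point of `s`.
      refine ⟨(Function.extend e w 0, Function.extend e z fun _ => x₀), ⟨⟨fun i => ?_, ?_⟩, ?_⟩, ?_⟩
      · by_cases hi : i ∈ Set.range e
        · obtain ⟨j, rfl⟩ := hi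
          simpa [e.injective.extend_apply] using (hw j).le
        · exact (hwe i hi).ge
      · rw [← hw1]
        exact (Fintype.sum_of_injective e e.injective _ _ hwe
          (fun i => (e.injective.extend_apply _ _ _).symm)).symm
      · intro i _
        by_cases hi : i ∈ Set.range e
        · obtain ⟨j, rfl⟩ := hi
          simpa [e.injective.extend_apply] using hz ⟨j, rfl⟩
        · simpa [Function.extend_apply' _ _ _ (show ¬ ∃ a, e a = i by simpa using hi)] using hx₀
      · refine (Fintype.sum_of_injective e e.injective _ _ (fun i hi => ?_) fun i => ?_).symm
        · simp [hwe i hi]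
        · simp [e.injective.extend_apply]
    · rintro _ ⟨⟨w, z⟩, ⟨hw, hz⟩, rfl⟩
      exact mem_convexHull_of_exists_fintype w z hw.1 hw.2 (fun i => hz i trivial) rfl
  rw [key]
  exact ((isCompact_stdSimplex ℝ _).prod (isCompact_univ_pi fun _ => hs)).image (by fun_prop)

/-! ### A norm inequality -/

/-- If the average of `‖c + x‖` and `‖c - x‖` is at most `u`, then on the segment from `-x` to `x`
the norm of `c + ·` lies below the affine function with value `u` at the centre and slope given by
`⟨c, ·⟩ / u`. The slope is the one for which the difference of the squares of the two sides is even
in `r`. -/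
theorem norm_add_le_of_norm_add_norm_sub_le {E : Type*} [NormedAddCommGroup E]
    [InnerProductSpace ℝ E] {c x : E} {u r : ℝ} (hu : 0 < u)
    (h : ‖c + x‖ + ‖c - x‖ ≤ 2 * u) (hr : |r| ≤ 1) :
    ‖c + r • x‖ ≤ u + r * (inner ℝ c x / u) := by
  have h1 := norm_add_sq_real c x
  have h2 := norm_sub_sq_real c x
  have h3 := norm_add_sq_real c (r • x)
  rw [inner_smul_right, norm_smul, mul_pow, Real.norm_eq_abs, sq_abs] at h3
  have p1 := norm_nonneg (c + x)
  have p2 := norm_nonneg (c - x)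
  have hcu : ‖c‖ ≤ u := by
    have h4 : ‖(c + x) + (c - x)‖ ≤ _ := norm_add_le _ _
    rw [show (c + x) + (c - x) = (2 : ℝ) • c by rw [two_smul]; abel, norm_smul] at h4
    norm_num at h4
    linarith
  generalize ‖c + x‖ = y at *
  generalize ‖c - x‖ = z at *
  generalize inner ℝ c x = g at *
  generalize ‖c + r • x‖ = v at *
  generalize ‖x‖ = m at *
  have hc0 : 0 ≤ ‖c‖ := by positivity
  generalize ‖c‖ = k at *
  have hg : 4 * g = (y + z) * (y - z) := by nlinarith
  have hgu : |g| ≤ u * u := by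
    rw [abs_le]; constructor <;> nlinarith
  have hr2 : r ^ 2 ≤ 1 := by rw [← sq_abs]; nlinarith [abs_nonneg r]
  have hrhs : 0 ≤ u + r * (g / u) := by
    have : |r * (g / u)| ≤ u := by
      rw [abs_mul, abs_div, abs_of_pos hu]
      calc |r| * (|g| / u) ≤ 1 * (u * u / u) := by gcongr
        _ = u := by field_simp
    linarith [neg_abs_le (r * (g / u))]
  have hA : u ^ 2 * (k ^ 2 + m ^ 2) ≤ u ^ 4 + g ^ 2 := by
    -- This is `(u² - P) (u² - Q) ≥ 0` for `P = (y + z)² / 4` and `Q = (y - z)² / 4`,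
    -- where `P + Q = k² + m²` and `P Q = g²`.
    have e1 : k ^ 2 + m ^ 2 = ((y + z) ^ 2 + (y - z) ^ 2) / 4 := by nlinarith
    have e2 : g ^ 2 = ((y + z) ^ 2 / 4) * ((y - z) ^ 2 / 4) := by
      rw [show g = (y + z) * (y - z) / 4 by linarith]; ring
    have a1 : (y + z) ^ 2 / 4 ≤ u ^ 2 := by nlinarith
    have a2 : (y - z) ^ 2 / 4 ≤ u ^ 2 := by nlinarith
    rw [e1, e2]
    nlinarith [mul_nonneg (sub_nonneg.2 a1) (sub_nonneg.2 a2)]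
  refine abs_le_of_sq_le_sq' ?_ hrhs |>.2
  rw [h3]
  have e : (u + r * (g / u)) ^ 2 = u ^ 2 + 2 * r * g + r ^ 2 * (g ^ 2 / u ^ 2) := by
    field_simp; ring
  rw [e]
  have hB : m ^ 2 ≤ u ^ 2 - k ^ 2 + g ^ 2 / u ^ 2 := by
    have : u ^ 2 * m ^ 2 ≤ u ^ 2 * (u ^ 2 - k ^ 2 + g ^ 2 / u ^ 2) := by
      have : u ^ 2 * (u ^ 2 - k ^ 2 + g ^ 2 / u ^ 2) = u ^ 4 - u ^ 2 * k ^ 2 + g ^ 2 := by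
        field_simp
      nlinarith
    exact le_of_mul_le_mul_left this (by positivity)
  have hk : k ^ 2 ≤ u ^ 2 := by nlinarith
  nlinarith [mul_le_mul_of_nonneg_left hB (sq_nonneg r),
    mul_nonneg (sub_nonneg.2 hr2) (sub_nonneg.2 hk)]

/-! ### Mixtures of measurements in a basis -/

/-- The space of Bloch vectors; the qubit states correspond to its closed unit ball. -/
abbrev BlochSpace : Type := EuclideanSpace ℝ (Fin 3)

/-- The parameters `(t, T)` of a qubit map that preserves the trace: the Bloch vector `t` of the
image of the maximally mixed state, and the real `3 × 3` matrix `T` of the action on Bloch vectors,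
given by its columns. -/
abbrev BlochParam : Type := BlochSpace × (Fin 3 → BlochSpace)

/-- The pair `(a, a bᵀ)`: the contribution of a measurement operator with Bloch vector `b`, on whose
outcome the state with Bloch vector `a` is prepared. -/
def blochTensor (a b : BlochSpace) : BlochParam := (a, fun j => b j • a)

/-- The parameters of the channels that measure in the orthonormal basis with Bloch vectors `±n` and
prepare the states with Bloch vectors `s₀` and `s₁`. A point of the domain is `(s₀, s₁, n)`. -/
def cqParams : Set BlochParam :=
  (fun x : BlochSpace × BlochSpace × BlochSpace =>
    (2⁻¹ : ℝ) • (blochTensor x.1 x.2.2 + blochTensor x.2.1 (-x.2.2))) ''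
    (Metric.closedBall 0 1 ×ˢ Metric.closedBall 0 1 ×ˢ Metric.sphere 0 1)

theorem isCompact_cqParams : IsCompact cqParams := by
  refine ((isCompact_closedBall _ _).prod
    ((isCompact_closedBall _ _).prod (isCompact_sphere _ _))).image ?_
  unfold blochTensor
  fun_prop

/-- The form of a linear functional on the parameters, by the Riesz representation theorem. -/
theorem exists_inner_blochTensor (l : StrongDual ℝ BlochParam) :
    ∃ (c : BlochSpace) (M : BlochSpace →ₗ[ℝ] BlochSpace),
      ∀ a b, l (blochTensor a b) = inner ℝ (c + M b) a := by
  let c := (InnerProductSpace.toDual ℝ BlochSpace).symm (l.comp (.inl ℝ _ _))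
  let m : Fin 3 → BlochSpace := fun j => (InnerProductSpace.toDual ℝ BlochSpace).symm
    (l.comp ((ContinuousLinearMap.inr ℝ _ _).comp (.single ℝ (fun _ => BlochSpace) j)))
  refine ⟨c, ∑ j, (EuclideanSpace.proj (𝕜 := ℝ) j).toLinearMap.smulRight (m j), fun a b => ?_⟩
  have h : blochTensor a b = ContinuousLinearMap.inl ℝ BlochSpace (Fin 3 → BlochSpace) a +
      ∑ j, b j • ContinuousLinearMap.inr ℝ BlochSpace (Fin 3 → BlochSpace)
        (ContinuousLinearMap.single ℝ (fun _ => BlochSpace) j a) := by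
    refine Prod.ext ?_ (funext fun i => ?_)
    · simp [blochTensor, Prod.fst_sum]
    · simp [blochTensor, Prod.snd_sum, Finset.sum_apply, Pi.single_apply]
  rw [h, map_add, map_sum]
  simp only [map_smul, LinearMap.sum_apply, LinearMap.smulRight_apply, inner_add_left, sum_inner,
    real_inner_smul_left, smul_eq_mul]
  have hc : inner ℝ c a = l (ContinuousLinearMap.inl ℝ BlochSpace (Fin 3 → BlochSpace) a) :=
    InnerProductSpace.toDual_symm_apply
  have hm : ∀ j, inner ℝ (m j) a = l (ContinuousLinearMap.inr ℝ BlochSpace (Fin 3 → BlochSpace)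
        (ContinuousLinearMap.single ℝ (fun _ => BlochSpace) j a)) := fun j =>
    InnerProductSpace.toDual_symm_apply
  simp only [hc, hm]
  rfl

theorem exists_inner_eq_norm {E : Type*} [NormedAddCommGroup E] [InnerProductSpace ℝ E] (y : E) :
    ∃ s : E, ‖s‖ ≤ 1 ∧ inner ℝ y s = ‖y‖ := by
  rcases eq_or_ne y 0 with rfl | hy
  · exact ⟨0, by simp⟩
  · have : ‖y‖ ≠ 0 := norm_ne_zero_iff.2 hy
    refine ⟨‖y‖⁻¹ • y, ?_, ?_⟩
    · rw [norm_smul, norm_inv, norm_norm, inv_mul_cancel₀ this]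
    · rw [inner_smul_right, real_inner_self_eq_norm_sq]
      field_simp

theorem exists_unit_smul_eq {E : Type*} [NormedAddCommGroup E] [NormedSpace ℝ E] [Nontrivial E]
    (b : E) : ∃ n : E, ‖n‖ = 1 ∧ ‖b‖ • n = b := by
  rcases eq_or_ne b 0 with rfl | hb
  · obtain ⟨n, hn⟩ := exists_norm_eq E zero_le_one
    exact ⟨n, hn, by simp⟩
  · have : ‖b‖ ≠ 0 := norm_ne_zero_iff.2 hb
    exact ⟨‖b‖⁻¹ • b, by rw [norm_smul, norm_inv, norm_norm, inv_mul_cancel₀ this],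
      by rw [smul_smul, mul_inv_cancel₀ this, one_smul]⟩

/-- A measure-and-prepare family whose measurement Bloch vectors average to zero has the same
parameters as a mixture of measurements in orthonormal bases. -/
theorem sum_blochTensor_mem_convexHull {ι : Type*} [Fintype ι] (w : ι → ℝ) (hw : ∀ i, 0 ≤ w i)
    (hw1 : ∑ i, w i = 1) (a b : ι → BlochSpace) (ha : ∀ i, ‖a i‖ ≤ 1) (hb : ∀ i, ‖b i‖ ≤ 1)
    (hwb : ∑ i, w i • b i = 0) :
    ∑ i, w i • blochTensor (a i) (b i) ∈ convexHull ℝ cqParams := by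
  by_contra hx
  obtain ⟨l, u, hl, hu⟩ := geometric_hahn_banach_closed_point (convex_convexHull ℝ cqParams)
    (isCompact_convexHull_of_finiteDimensional isCompact_cqParams).isClosed hx
  obtain ⟨c, M, hcM⟩ := exists_inner_blochTensor l
  have hcq : ∀ s₀ s₁ n : BlochSpace, ‖s₀‖ ≤ 1 → ‖s₁‖ ≤ 1 → ‖n‖ = 1 →
      inner ℝ (c + M n) s₀ + inner ℝ (c - M n) s₁ < 2 * u := by
    intro s₀ s₁ n h₀ h₁ hn
    have := hl _ (subset_convexHull ℝ _ ⟨(s₀, s₁, n), by simp [h₀, h₁, hn], rfl⟩)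
    rw [map_smul, map_add, hcM, hcM, map_neg, ← sub_eq_add_neg, smul_eq_mul] at this
    linarith
  have hu0 : 0 < u := by
    obtain ⟨n, hn⟩ := exists_norm_eq BlochSpace zero_le_one
    simpa using hcq 0 0 n (by simp) (by simp) hn
  -- Every `x` in the ball is `‖x‖ • n` with `n` a unit vector, so it lies on a segment `[-n, n]`.
  have hball : ∀ x : BlochSpace, ‖x‖ ≤ 1 → ‖c + M x‖ ≤ u + inner ℝ c (M x) / u := by
    intro x hx
    obtain ⟨n, hn, hnx⟩ := exists_unit_smul_eq x
    obtain ⟨s₀, h₀, h₀'⟩ := exists_inner_eq_norm (c + M n)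
    obtain ⟨s₁, h₁, h₁'⟩ := exists_inner_eq_norm (c - M n)
    have h := hcq s₀ s₁ n h₀ h₁ hn
    rw [h₀', h₁'] at h
    have := norm_add_le_of_norm_add_norm_sub_le hu0 h.le
      (r := ‖x‖) (by rwa [abs_norm])
    rw [← map_smul, hnx] at this
    rwa [← hnx, map_smul, inner_smul_right, mul_div_assoc, ← map_smul, hnx]
  refine absurd hu (not_lt.2 ?_)
  rw [map_sum]
  calc ∑ i, l (w i • blochTensor (a i) (b i))
      ≤ ∑ i, w i * (u + inner ℝ c (M (b i)) / u) := by
        refine Finset.sum_le_sum fun i _ => ?_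
        rw [map_smul, smul_eq_mul, hcM]
        refine mul_le_mul_of_nonneg_left ?_ (hw i)
        calc inner ℝ (c + M (b i)) (a i) ≤ ‖c + M (b i)‖ * ‖a i‖ := real_inner_le_norm _ _
          _ ≤ ‖c + M (b i)‖ * 1 := by gcongr; exact ha i
          _ ≤ _ := by rw [mul_one]; exact hball _ (hb i)
    _ = (∑ i, w i) * u + inner ℝ c (M (∑ i, w i • b i)) / u := by
        simp only [map_sum, map_smul, inner_sum, inner_smul_right, Finset.sum_mul, Finset.sum_div,
          ← Finset.sum_add_distrib]
        exact Finset.sum_congr rfl fun i _ => by ring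
    _ = u := by rw [hw1, hwb]; simp

/-! ### The Bloch representation of qubit states -/

/-- The matrix `(1 + s·σ) / 2` with Bloch vector `s`. -/
noncomputable def bloch (s : BlochSpace) : Op 2 :=
  !![(1 + s 2) / 2, (s 0 - s 1 * Complex.I) / 2; (s 0 + s 1 * Complex.I) / 2, (1 - s 2) / 2]

theorem norm_sq_blochSpace (s : BlochSpace) : ‖s‖ ^ 2 = s 0 ^ 2 + s 1 ^ 2 + s 2 ^ 2 := by
  simp [EuclideanSpace.norm_sq_eq, Fin.sum_univ_three]

/-- A unit vector `(x, z)` of `ℂ²` over the point `(p, q, r)` of the unit sphere, with the phase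
chosen so that the first component is real. -/
theorem exists_spinor {p q r : ℝ} (hsq : p ^ 2 + q ^ 2 + r ^ 2 = 1) :
    ∃ (x : ℝ) (z : ℂ), (x : ℂ) * x = (1 + r) / 2 ∧ z * starRingEnd ℂ z = (1 - r) / 2 ∧
      z * x = (p + q * Complex.I) / 2 := by
  -- At the south pole `x = 0`, and the general formula for `z` would divide by zero.
  rcases eq_or_ne r (-1) with rfl | h
  · refine ⟨0, 1, by norm_num, by norm_num, ?_⟩
    have h0 : p = 0 := by nlinarith [sq_nonneg p, sq_nonneg q]
    have h1 : q = 0 := by nlinarith [sq_nonneg p, sq_nonneg q]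
    simp [h0, h1]
  · have hpos : 0 < (1 + r) / 2 := by
      have : -1 < r := lt_of_le_of_ne (by nlinarith [sq_nonneg p, sq_nonneg q]) h.symm
      linarith
    have hx := Real.mul_self_sqrt hpos.le
    have hx0 : (√((1 + r) / 2) : ℂ) ≠ 0 := by
      exact_mod_cast (Real.sqrt_pos.2 hpos).ne'
    have hxc : (√((1 + r) / 2) : ℂ) * √((1 + r) / 2) = (1 + r) / 2 := by exact_mod_cast hx
    refine ⟨√((1 + r) / 2), (p + q * Complex.I) / 2 / √((1 + r) / 2), hxc, ?_, ?_⟩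
    · have hc : (p : ℂ) ^ 2 + q ^ 2 + r ^ 2 = 1 := by exact_mod_cast hsq
      have h2 : (1 + r : ℂ) ≠ 0 := by
        exact_mod_cast (show (1 + r) ≠ 0 by linarith)
      simp only [map_div₀, map_add, map_mul, Complex.conj_ofReal, Complex.conj_I, map_ofNat]
      rw [div_mul_div_comm, hxc]
      field_simp
      linear_combination hc - (q : ℂ) ^ 2 * Complex.I_sq
    · field_simp

theorem exists_basis_ketBra_eq_bloch (n : BlochSpace) (hn : ‖n‖ = 1) :
    ∃ ψ : OrthonormalBasis (Fin 2) ℂ (EuclideanSpace ℂ (Fin 2)),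
      ketBra (ψ 0) = bloch n ∧ ketBra (ψ 1) = bloch (-n) := by
  have hsq : n 0 ^ 2 + n 1 ^ 2 + n 2 ^ 2 = 1 := by rw [← norm_sq_blochSpace, hn]; norm_num
  obtain ⟨x, z, hxc, hz0, hz1⟩ := exists_spinor hsq
  have hz1' : x * starRingEnd ℂ z = (n 0 - n 1 * Complex.I) / 2 := by
    have := congrArg (starRingEnd ℂ) hz1
    simp only [map_div₀, map_add, map_mul, Complex.conj_ofReal, Complex.conj_I, map_ofNat] at this
    rw [mul_comm, this]; ring
  let v : Fin 2 → EuclideanSpace ℂ (Fin 2) :=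
    ![!₂[(x : ℂ), z], !₂[-(starRingEnd ℂ z), (x : ℂ)]]
  have hv : Orthonormal ℂ v := by
    rw [orthonormal_iff_ite]
    intro i j
    rw [PiLp.inner_apply, Fin.sum_univ_two, RCLike.inner_apply, RCLike.inner_apply]
    fin_cases i <;> fin_cases j <;> simp [v]
    · linear_combination hxc + hz0
    · ring
    · ring
    · linear_combination hxc + hz0
  refine ⟨OrthonormalBasis.mk hv
    (hv.linearIndependent.span_eq_top_of_card_eq_finrank' (by simp)).ge, ?_, ?_⟩
  · rw [OrthonormalBasis.coe_mk]
    ext i j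
    fin_cases i <;> fin_cases j <;>
      simp [v, ketBra, bloch, Matrix.vecMulVec_apply, hxc, hz0, hz1, hz1']
  · rw [OrthonormalBasis.coe_mk]
    ext i j
    fin_cases i <;> fin_cases j <;>
      simp [v, ketBra, bloch, Matrix.vecMulVec_apply]
    · linear_combination hz0
    · linear_combination -hz1'
    · linear_combination -hz1
    · linear_combination hxc

theorem isDensityMatrix_bloch {s : BlochSpace} (hs : ‖s‖ ≤ 1) : IsDensityMatrix (bloch s) := by
  refine ⟨?_, by simp [bloch, Matrix.trace_fin_two]; ring⟩
  obtain ⟨n, hn, hns⟩ := exists_unit_smul_eq s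
  obtain ⟨ψ, h0, h1⟩ := exists_basis_ketBra_eq_bloch n hn
  -- The spectral decomposition of `bloch s`.
  have key : bloch s = ((1 + ‖s‖) / 2) • ketBra (ψ 0) + ((1 - ‖s‖) / 2) • ketBra (ψ 1) := by
    have hj : ∀ j, (s j : ℂ) = ‖s‖ * n j := fun j => by
      nth_rewrite 1 [← hns]
      simp
    rw [h0, h1]
    ext i j
    fin_cases i <;> fin_cases j <;> simp [bloch, hj] <;> ring
  rw [key]
  exact ((Matrix.posSemidef_vecMulVec_self_star _).smul (by linarith [norm_nonneg s])).add
    ((Matrix.posSemidef_vecMulVec_self_star _).smul (by linarith))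

/-- The norm bound is the nonnegativity of the determinant, `4 det ρ = 1 - ‖s‖²`. -/
theorem IsDensityMatrix.exists_bloch {ρ : Op 2} (h : IsDensityMatrix ρ) :
    ∃ s : BlochSpace, ‖s‖ ≤ 1 ∧ ρ = bloch s := by
  obtain ⟨hp, ht⟩ := h
  have hherm : ∀ i j, starRingEnd ℂ (ρ j i) = ρ i j := fun i j => hp.1.apply i j
  have him : ∀ i, (ρ i i).im = 0 := fun i => Complex.conj_eq_iff_im.1 (hherm i i)
  have h00 := him 0
  have h11 := him 1
  have h01 := hherm 0 1
  rw [Matrix.trace_fin_two] at ht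
  have htr : (ρ 0 0).re + (ρ 1 1).re = 1 := by simpa using congrArg Complex.re ht
  have hdet := (Complex.le_def.1 hp.det_nonneg).1
  rw [Matrix.det_fin_two, ← h01] at hdet
  simp [h00, h11] at hdet
  refine ⟨!₂[2 * (ρ 1 0).re, 2 * (ρ 1 0).im, 2 * (ρ 0 0).re - 1], ?_, ?_⟩
  · refine abs_le_of_sq_le_sq' (b := 1) ?_ zero_le_one |>.2
    rw [norm_sq_blochSpace]
    simp
    have h1 : (ρ 1 1).re = 1 - (ρ 0 0).re := by linarith
    rw [h1] at hdet
    nlinarith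
  · ext i j
    fin_cases i <;> fin_cases j <;> apply Complex.ext <;> simp [bloch, ← h01, h00, h11]
    all_goals linarith

/-! ### Qubit maps in terms of their parameters -/

theorem trace_mul_fin_two (A X : Op 2) :
    (A * X).trace = A 0 0 * X 0 0 + A 0 1 * X 1 0 + (A 1 0 * X 0 1 + A 1 1 * X 1 1) := by
  simp [Matrix.trace_fin_two, Matrix.mul_apply]

/-- The traceless Hermitian matrix `s·σ`. -/
noncomputable def pauliVec : BlochSpace →ₗ[ℝ] Op 2 where
  toFun s := !![(s 2 : ℂ), s 0 - s 1 * Complex.I; s 0 + s 1 * Complex.I, -(s 2 : ℂ)]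
  map_add' s t := by
    ext i j
    fin_cases i <;> fin_cases j <;> simp <;> ring
  map_smul' c s := by
    ext i j
    fin_cases i <;> fin_cases j <;> simp <;> ring

theorem pauliVec_eq_zero {s : BlochSpace} (h : ∀ X, (pauliVec s * X).trace = 0) : s = 0 := by
  have h0 := h !![1, 0; 0, 0]
  have h1 := h !![0, 1; 0, 0]
  rw [trace_mul_fin_two] at h0 h1
  simp [pauliVec, Complex.ext_iff] at h0 h1
  ext j
  fin_cases j <;> simp [h0, h1]

theorem two_mul_trace_bloch_mul (b : BlochSpace) (X : Op 2) :
    2 * (bloch b * X).trace = X.trace + (pauliVec b * X).trace := by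
  rw [trace_mul_fin_two, trace_mul_fin_two]
  simp [bloch, pauliVec, Matrix.trace_fin_two]
  ring

/-- The part `X ↦ (Tr[X] t·σ + ∑ⱼ Tr[σⱼ X] Tⱼ·σ) / 2` of `blochMap (t, T)`, which depends linearly
on the parameters. -/
noncomputable def blochCorrection (z : BlochParam) : Op 2 →ₗ[ℂ] Op 2 where
  toFun X := (2⁻¹ : ℂ) • (X.trace • pauliVec z.1 +
    ∑ j, (pauliVec (EuclideanSpace.single j 1) * X).trace • pauliVec (z.2 j))
  map_add' X Y := by
    simp only [Matrix.trace_add, mul_add, add_smul, Finset.sum_add_distrib, ← smul_add]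
    congr 1
    abel
  map_smul' c X := by
    simp only [Matrix.trace_smul, Matrix.mul_smul, smul_assoc, RingHom.id_apply,
      ← Finset.smul_sum, ← smul_add]
    rw [smul_comm]

/-- The trace-preserving qubit map `X ↦ (Tr[X] (1 + t·σ) + ∑ⱼ Tr[σⱼ X] Tⱼ·σ) / 2` with parameters
`(t, T)`. -/
noncomputable def blochMap (z : BlochParam) : Op 2 →ₗ[ℂ] Op 2 :=
  (2⁻¹ : ℂ) • (Matrix.traceLinearMap (Fin 2) ℂ ℂ).smulRight 1 + blochCorrection z

/-- `blochMap` is affine in the parameters. -/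
theorem blochMap_sum {ι : Type*} [Fintype ι] (w : ι → ℝ) (hw : ∑ i, w i = 1) (z : ι → BlochParam)
    (X : Op 2) : blochMap (∑ i, w i • z i) X = ∑ i, w i • blochMap (z i) X := by
  simp only [blochMap, LinearMap.add_apply, smul_add, Finset.sum_add_distrib, ← Finset.sum_smul, hw,
    one_smul]
  congr 1
  simp only [blochCorrection, LinearMap.coe_mk, AddHom.coe_mk, Prod.fst_sum, Prod.snd_sum,
    Prod.smul_fst, Prod.smul_snd, Finset.sum_apply, Pi.smul_apply, map_sum, map_smul, Finset.smul_sum, smul_add,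
    Finset.sum_add_distrib, smul_comm (_ : ℂ) (_ : ℝ)]
  rw [Finset.sum_comm]

theorem blochMap_apply (z : BlochParam) (X : Op 2) :
    blochMap z X = ((2⁻¹ : ℂ) * X.trace) • (1 : Op 2) + (2⁻¹ : ℂ) • (X.trace • pauliVec z.1 +
      ∑ j, (pauliVec (EuclideanSpace.single j 1) * X).trace • pauliVec (z.2 j)) := by
  rw [mul_smul]
  rfl

/-- A single measure-and-prepare term is `blochMap` up to a term linear in `b`, which vanishes in
averages with mean Bloch vector zero. -/
theorem measure_prepare_eq_blochMap (a b : BlochSpace) (X : Op 2) :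
    (2 * (bloch b * X).trace) • bloch a =
      blochMap (blochTensor a b) X + (2⁻¹ * (pauliVec b * X).trace) • (1 : Op 2) := by
  simp only [blochMap_apply, trace_mul_fin_two, Fin.sum_univ_three]
  ext i j
  fin_cases i <;> fin_cases j <;>
    simp [bloch, pauliVec, blochTensor, Matrix.trace_fin_two] <;> ring

theorem sum_measure_prepare_eq_blochMap {ι : Type*} [Fintype ι] (w : ι → ℝ) (hw : ∑ i, w i = 1)
    (a b : ι → BlochSpace) (hwb : ∑ i, w i • b i = 0) (X : Op 2) :
    ∑ i, w i • (2 * (bloch (b i) * X).trace) • bloch (a i) =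
      blochMap (∑ i, w i • blochTensor (a i) (b i)) X := by
  have h : ∑ i, w i • (pauliVec (b i) * X).trace = 0 := by
    simp only [← Matrix.trace_smul, ← Matrix.smul_mul, ← map_smul, ← Matrix.trace_sum,
      ← Matrix.sum_mul, ← map_sum, hwb]
    simp
  simp only [measure_prepare_eq_blochMap, smul_add, Finset.sum_add_distrib, blochMap_sum w hw]
  rw [add_eq_left]
  calc ∑ i, w i • (2⁻¹ * (pauliVec (b i) * X).trace) • (1 : Op 2)
      = (2⁻¹ * ∑ i, w i • (pauliVec (b i) * X).trace) • (1 : Op 2) := by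
        rw [Finset.mul_sum, Finset.sum_smul]
        exact Finset.sum_congr rfl fun i _ => by rw [← smul_assoc, mul_smul_comm]
    _ = 0 := by rw [h, mul_zero, zero_smul]

/-! ### Decomposition of entanglement-breaking channels -/

theorem cqMap_apply (ψ : OrthonormalBasis (Fin 2) ℂ (EuclideanSpace ℂ (Fin 2)))
    (σ : Fin 2 → Op 2) (X : Op 2) :
    cqMap ψ σ X = ∑ m, (ketBra (ψ m) * X).trace • σ m := by
  change ∑ m, (star (ψ m).ofLp ⬝ᵥ (X *ᵥ (ψ m).ofLp)) • σ m = _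
  refine Finset.sum_congr rfl fun m _ => ?_
  rw [ketBra, Matrix.vecMulVec_mul, Matrix.trace_vecMulVec, Matrix.dotProduct_mulVec,
    dotProduct_comm]

theorem exists_cqMap_eq_blochMap {z : BlochParam} (hz : z ∈ cqParams) :
    ∃ (ψ : OrthonormalBasis (Fin 2) ℂ (EuclideanSpace ℂ (Fin 2))) (σ : Fin 2 → Op 2),
      (∀ m, IsDensityMatrix (σ m)) ∧ cqMap ψ σ = blochMap z := by
  obtain ⟨⟨s₀, s₁, n⟩, ⟨h₀, h₁, hn⟩, rfl⟩ := hz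
  simp only [mem_closedBall_zero_iff, mem_sphere_zero_iff_norm] at h₀ h₁ hn
  obtain ⟨ψ, hψ₀, hψ₁⟩ := exists_basis_ketBra_eq_bloch n hn
  refine ⟨ψ, ![bloch s₀, bloch s₁], ?_, LinearMap.ext fun X => ?_⟩
  · rw [Fin.forall_fin_two]
    exact ⟨isDensityMatrix_bloch h₀, isDensityMatrix_bloch h₁⟩
  · have h := sum_measure_prepare_eq_blochMap (fun _ : Fin 2 => (2⁻¹ : ℝ)) (by norm_num)
      ![s₀, s₁] ![n, -n] (by simp) X
    simp only [Fin.sum_univ_two, Matrix.cons_val_zero, Matrix.cons_val_one, ← smul_add] at h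
    rw [← h, cqMap_apply, Fin.sum_univ_two, hψ₀, hψ₁]
    simp [mul_smul, ← smul_add, ← Complex.coe_smul]

/-- The measure-and-prepare form of an entanglement-breaking channel, read off from a separable
decomposition of its Choi state. The measurement operators `2 pₖ ρ(bₖ)` are the transposes of the
second tensor factors. -/
theorem IsEntanglementBreaking.exists_measure_prepare {N : Op 2 →ₗ[ℂ] Op 2}
    (hN : IsEntanglementBreaking N) :
    ∃ (n : ℕ) (p : Fin n → ℝ) (a b : Fin n → BlochSpace), p ∈ stdSimplex ℝ (Fin n) ∧
      (∀ k, ‖a k‖ ≤ 1) ∧ (∀ k, ‖b k‖ ≤ 1) ∧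
      ∀ X, N X = ∑ k, p k • (2 * (bloch (b k) * X).trace) • bloch (a k) := by
  obtain ⟨c, hc⟩ : ∃ c : ℝ, c * c = 2⁻¹ := ⟨√2⁻¹, Real.mul_self_sqrt (by norm_num)⟩
  have hcc : (c : ℂ) * c = 2⁻¹ := by rw [← Complex.ofReal_mul, hc]; norm_num
  -- `Ψ` is the maximally entangled vector, with coefficients `c = 1 / √2`.
  let Ψ : EuclideanSpace ℂ (Fin 2 × Fin 2) :=
    WithLp.toLp 2 fun x => if x.2 = x.1 then (c : ℂ) else 0
  have hΨ : ‖Ψ‖ = 1 := by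
    rw [EuclideanSpace.norm_eq, Real.sqrt_eq_one, Fintype.sum_prod_type]
    simp [Ψ, Fin.sum_univ_two]
    linarith
  obtain ⟨n, p, ρ, τ, hp, hρ, hτ, h⟩ := hN.separable Ψ hΨ
  choose a ha hρa using fun k => (hρ k).exists_bloch
  have hτ' : ∀ k, IsDensityMatrix (τ k)ᵀ := fun k =>
    ⟨(hτ k).1.transpose, by rw [Matrix.trace_transpose, (hτ k).2]⟩
  choose b hb hτb using fun k => (hτ' k).exists_bloch
  have hblock : ∀ i j, N (Matrix.single i j 1) = ∑ k, p k • (2 * τ k i j) • ρ k := by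
    intro i j
    ext x y
    have hxy := congrFun (congrFun h (x, i)) (y, j)
    have e : (Matrix.of fun k l => ketBra Ψ (k, i) (l, j)) =
        (2⁻¹ : ℂ) • Matrix.single i j (1 : ℂ) := by
      ext k l
      by_cases hk : i = k <;> by_cases hl : j = l <;>
        simp [Ψ, ketBra, Matrix.vecMulVec_apply, hk, hl, hcc]
    change N (Matrix.of fun k l => ketBra Ψ (k, i) (l, j)) x y = _ at hxy
    rw [e, map_smul, Matrix.smul_apply, smul_eq_mul, inv_mul_eq_iff_eq_mul₀ two_ne_zero] at hxy
    rw [hxy, Matrix.sum_apply, Matrix.sum_apply, Finset.mul_sum]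
    refine Finset.sum_congr rfl fun k _ => ?_
    simp
    ring
  refine ⟨n, p, a, b, hp, ha, hb, fun X => ?_⟩
  conv_lhs => rw [Matrix.matrix_eq_sum_single X]
  have hX : ∀ i j, N (Matrix.single i j (X i j)) = X i j • N (Matrix.single i j 1) := fun i j => by
    rw [← map_smul, Matrix.smul_single, smul_eq_mul, mul_one]
  simp only [map_sum, hX, hblock, ← hτb, ← hρa]
  ext x y
  simp [Fin.sum_univ_two, Matrix.trace_fin_two, Matrix.mul_apply, Matrix.sum_apply,
    Finset.mul_sum, ← Finset.sum_add_distrib]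
  refine Finset.sum_congr rfl fun k _ => ?_
  ring

theorem sum_smul_eq_zero_of_tracePreserving {ι : Type*} [Fintype ι] {N : Op 2 →ₗ[ℂ] Op 2}
    (hN : ∀ X, (N X).trace = X.trace) {p : ι → ℝ} (hp : ∑ k, p k = 1) {a b : ι → BlochSpace}
    (h : ∀ X, N X = ∑ k, p k • (2 * (bloch (b k) * X).trace) • bloch (a k)) :
    ∑ k, p k • b k = 0 := by
  refine pauliVec_eq_zero fun X => ?_
  have htr : ∀ s, (bloch s).trace = 1 := fun s => by simp [bloch, Matrix.trace_fin_two]; ring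
  have hX := hN X
  simp only [h, Matrix.trace_sum, Matrix.trace_smul, htr, smul_eq_mul, mul_one,
    two_mul_trace_bloch_mul, smul_add, Finset.sum_add_distrib, ← Finset.sum_smul, hp, one_smul,
    add_eq_left] at hX
  simpa only [map_sum, map_smul, Matrix.sum_mul, Matrix.smul_mul, Matrix.trace_sum,
    Matrix.trace_smul] using hX

/-- Every entanglement-breaking qubit channel is a mixture of channels that measure in an orthonormal
basis. -/
theorem IsEntanglementBreaking.exists_cqMap {N : Op 2 →ₗ[ℂ] Op 2}
    (hN : IsEntanglementBreaking N) :
    ∃ (K : ℕ) (q : Fin K → ℝ) (ψ : Fin K → OrthonormalBasis (Fin 2) ℂ (EuclideanSpace ℂ (Fin 2)))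
      (σ : Fin K → Fin 2 → Op 2), q ∈ stdSimplex ℝ (Fin K) ∧ (∀ i m, IsDensityMatrix (σ i m)) ∧
      N = ∑ i, (q i : ℂ) • cqMap (ψ i) (σ i) := by
  obtain ⟨n, p, a, b, hp, ha, hb, hNX⟩ := hN.exists_measure_prepare
  have hpb := sum_smul_eq_zero_of_tracePreserving hN.isQuantumChannel.tracePreserving hp.2 hNX
  obtain ⟨ι, _, w, z, hw, hw1, hz, hsum⟩ := mem_convexHull_iff_exists_fintype.1
    (sum_blochTensor_mem_convexHull p hp.1 hp.2 a b ha hb hpb)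
  choose ψ σ hσ hψ using fun i => exists_cqMap_eq_blochMap (hz i)
  let e := (Fintype.equivFin ι).symm
  refine ⟨Fintype.card ι, w ∘ e, ψ ∘ e, σ ∘ e, ⟨fun i => hw _, ?_⟩, fun i => hσ _, ?_⟩
  · rw [← hw1]
    exact e.sum_comp w
  · refine LinearMap.ext fun X => ?_
    rw [hNX, sum_measure_prepare_eq_blochMap p hp.2 a b hpb, ← hsum, blochMap_sum w hw1,
      LinearMap.sum_apply]
    simp only [Function.comp_apply, hψ, LinearMap.smul_apply, Complex.coe_smul]
    exact (e.sum_comp fun i => w i • blochMap (z i) X).symm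

theorem cqProtocol_realizedMap {K : ℕ} (q : Fin K → ℝ) (hq : q ∈ stdSimplex ℝ (Fin K))
    (ψ : Fin K → OrthonormalBasis (Fin 2) ℂ (EuclideanSpace ℂ (Fin 2)))
    (σ : Fin K → Fin 2 → Op 2) (hσ : ∀ i m, IsDensityMatrix (σ i m)) :
    (cqProtocol q hq ψ σ hσ).realizedMap noiselessBit = ∑ i, (q i : ℂ) • cqMap (ψ i) (σ i) := by
  refine LinearMap.ext fun X => ?_
  simp only [LinearMap.sum_apply, LinearMap.smul_apply, cqMap_apply, Finset.smul_sum]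
  change ∑ i, ∑ j, ∑ m, ∑ m', (((if i = j then q j else 0 : ℝ) : ℂ) *
    (ketBra (ψ i m) * X).trace * (noiselessBit m m' : ℂ)) • σ j m' = _
  refine Finset.sum_congr rfl fun i _ => ?_
  rw [Finset.sum_eq_single i (fun j _ hj => by simp [hj.symm]) (by simp)]
  refine Finset.sum_congr rfl fun m _ => ?_
  rw [Finset.sum_eq_single m (fun m' _ hm => by simp [noiselessBit, hm.symm]) (by simp)]
  simp [noiselessBit, mul_smul]

theorem proposition1 (N : Op 2 →ₗ[ℂ] Op 2) (hN : IsEntanglementBreaking N) :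
    (∃ (KA KB : ℕ) (P : BitProtocol 2 KA KB), P.Simulates N) ∧
    ∃ (K : ℕ) (q : Fin K → ℝ) (hq : q ∈ stdSimplex ℝ (Fin K))
      (ψ : Fin K → OrthonormalBasis (Fin 2) ℂ (EuclideanSpace ℂ (Fin 2)))
      (σ : Fin K → Fin 2 → Op 2) (hσ : ∀ i m, IsDensityMatrix (σ i m)),
      0 < K ∧
      N = ∑ i, (q i : ℂ) • cqMap (ψ i) (σ i) ∧
      (cqProtocol q hq ψ σ hσ).Simulates N := by
  obtain ⟨K, q, ψ, σ, hq, hσ, h⟩ := hN.exists_cqMap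
  have hsim : (cqProtocol q hq ψ σ hσ).Simulates N :=
    (cqProtocol_realizedMap q hq ψ σ hσ).trans h.symm
  refine ⟨⟨K, K, _, hsim⟩, K, q, hq, ψ, σ, hσ, ?_, h, hsim⟩
  -- Weights over an empty index set cannot sum to one.
  rcases Nat.eq_zero_or_pos K with rfl | hK
  · simpa using hq.2
  · exact hK
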